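/- Let $H=\ell^2(\mathbb{Z}_+)$ with orthonormal basis $(e_n)_{n\ge 0}$, let $T e_n=e_{n+1}$ be the right shift, and let $\mathcal{T}\subset B(H)$ be the Toeplitz algebra, i.e. the norm closed unital $*$-algebra generated by $T$. Put $T_{n,m}=T^nT^{*m}$ for $n,m\in\mathbb{Z}_+$. Let $\mathcal{T}\otimes\mathcal{T}$ be the minimal $C^*$-tensor product and $\Delta\colon\mathcal{T}\to\mathcal{T}\otimes\mathcal{T}$ the unital $*$-homomorphism with $\Delta(T)=T\otimes T$. On the space $\mathcal{T}^*$ of continuous linear functionals define $(\rho*\varphi)(A)=(\rho\otimes\varphi)(\Delta(A))$. A state $h\in\mathcal{T}^*$ is called a Haar functional if for every $\rho\in\mathcal{T}^*$ there is $\lambda_\rho\in\mathbb{C}$ with $h*\rho=\rho*h=\lambda_\rho h$. There is exactly one Haar functional $h$ in $\mathcal{T}^*$. Let $\rho$ be a faithful state on $\mathcal{T}$ (that is, $\rho(A^*A)=0$ only for $A=0$), and let $\rho_N=\frac1N\sum_{k=1}^N\rho^{*k}$ be the Cesàro means of its convolution powers. Then $$|\rho(T_{n,m})|<1\quad\text{for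 all }(n,m)\neq(0,0),$$ and $$\lim_{N\to\infty}\rho_N=h .$$ The convergence holds on the generators, $$\lim_{N\to\infty}\rho_N(T_{n,m})=h(T_{n,m})=\begin{cases}1,& n=m=0,\\ 0,&(n,m)\ne(0,0),\end{cases}$$ pointwise, $\rho_N(A)\to h(A)$ for every $A\in\mathcal{T}$, and also in the norm of $\mathcal{T}^*$. -/

import Mathlib

open Filter Topology
open scoped ComplexConjugate lp ComplexOrder InnerProductSpace

noncomputable section

namespace Toeplitz

/-- The Hilbert space `l²(ℤ₊)`. -/
abbrev H : Type := ℓ²(ℕ, ℂ)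

/-- The Hilbert space `l²(ℤ₊) ⊗ l²(ℤ₊)`, realised as `l²(ℤ₊ × ℤ₊)`
(the vector `x ⊗ y` is the function `(i, j) ↦ x i * y j`, see `tensorVec`). -/
abbrev HH : Type := ℓ²(ℕ × ℕ, ℂ)

/-! ### Elementary facts on `l²` -/

theorem two_toReal_pos : 0 < (2 : ENNReal).toReal := by norm_num

theorem memlp_two {ι : Type*} {f : ι → ℂ} (hf : Summable fun i => ‖f i‖ ^ 2) :
    Memℓp f 2 := by
  apply memℓp_gen
  simpa using hf

theorem summable_sq {ι : Type*} (f : ℓ²(ι, ℂ)) : Summable fun i => ‖f i‖ ^ 2 := by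
  have h := (lp.memℓp f).summable two_toReal_pos
  simpa using h

theorem norm_sq_eq {ι : Type*} (f : ℓ²(ι, ℂ)) : ‖f‖ ^ 2 = ∑' i, ‖f i‖ ^ 2 := by
  have h := lp.norm_rpow_eq_tsum two_toReal_pos f
  simpa using h

/-! ### The shift and the Toeplitz algebra -/

/-- The value of the right shift on a sequence: `(Tf) 0 = 0`, `(Tf) (n + 1) = f n`. -/
def shiftFun (f : ℕ → ℂ) : ℕ → ℂ
  | 0 => 0
  | n + 1 => f n

theorem shiftFun_summable (f : H) : Summable fun i => ‖shiftFun f i‖ ^ 2 := by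
  rw [← summable_nat_add_iff 1]
  exact summable_sq f

/-- The right shift `T` on `l²(ℤ₊)`, so that `T eₙ = eₙ₊₁`. -/
def shift : H →L[ℂ] H :=
  LinearMap.mkContinuous
    { toFun := fun f => ⟨shiftFun f, memlp_two (shiftFun_summable f)⟩
      map_add' := by
        intro f g
        ext i
        cases i
        · exact (add_zero _).symm
        · rfl
      map_smul' := by
        intro c f
        ext i
        cases i
        · exact (mul_zero _).symm
        · rfl } 1 (by
    intro f
    rw [one_mul]
    refine le_of_eq ((sq_eq_sq₀ (norm_nonneg _) (norm_nonneg _)).1 ?_)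
    rw [norm_sq_eq, norm_sq_eq]
    change ∑' i, ‖shiftFun f i‖ ^ 2 = _
    rw [(shiftFun_summable f).tsum_eq_zero_add]
    simp [shiftFun])

theorem shift_apply (f : H) (i : ℕ) : shift f i = shiftFun f i := rfl

/-- The Toeplitz algebra `𝒯`: the norm closed (unital) star subalgebra of `B(l²(ℤ₊))`
generated by the shift. -/
def 𝒯 : StarSubalgebra ℂ (H →L[ℂ] H) := StarAlgebra.elemental ℂ shift

/-- The generator `T` as an element of `𝒯`. -/
def genT : 𝒯 := ⟨shift, StarAlgebra.elemental.self_mem ℂ shift⟩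

/-- The operators `T_{n,m} = Tⁿ T*ᵐ`. -/
def T (n m : ℕ) : 𝒯 := genT ^ n * star genT ^ m

/-- The dual space `𝒯*` of continuous linear functionals, with its usual norm. -/
abbrev Dual𝒯 : Type := StrongDual ℂ 𝒯

/-! ### Operators acting fibrewise on `l²(ℤ₊ × ℤ₊)` -/

section Fibre

variable {κ : Type} (e : κ × ℕ ≃ ℕ × ℕ)

theorem fibre_summable (f : HH) (k : κ) : Summable fun n => ‖f (e (k, n))‖ ^ 2 :=
  (summable_sq f).comp_injective (i := fun n => e (k, n))
    (fun a b h => by simpa using e.injective h)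

/-- The restriction of `f` to the `k`-th fibre `{e (k, n) | n}` of `ℤ₊ × ℤ₊`. -/
def fibre (f : HH) (k : κ) : H := ⟨fun n => f (e (k, n)), memlp_two (fibre_summable e f k)⟩

theorem fibre_apply (f : HH) (k : κ) (n : ℕ) : fibre e f k n = f (e (k, n)) := rfl

theorem ext_fibre {f g : HH} (h : ∀ k, fibre e f k = fibre e g k) : f = g := by
  ext p
  obtain ⟨⟨k, n⟩, rfl⟩ := e.surjective p
  rw [← fibre_apply, h, fibre_apply]

theorem hasSum_fibre (f : HH) : HasSum (fun k => ‖fibre e f k‖ ^ 2) (‖f‖ ^ 2) := by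
  have h1 : HasSum (fun q : κ × ℕ => ‖f (e q)‖ ^ 2) (‖f‖ ^ 2) := by
    rw [norm_sq_eq]
    exact (e.hasSum_iff (f := fun p => ‖f p‖ ^ 2)).2 (summable_sq f).hasSum
  refine h1.prod_fiberwise fun k => ?_
  rw [norm_sq_eq]
  exact (summable_sq (fibre e f k)).hasSum

theorem hasSum_inner_fibre (f g : HH) :
    HasSum (fun k => ⟪fibre e f k, fibre e g k⟫_ℂ) ⟪f, g⟫_ℂ := by
  have h1 : HasSum (fun q : κ × ℕ => ⟪f (e q), g (e q)⟫_ℂ) ⟪f, g⟫_ℂ :=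
    (e.hasSum_iff (f := fun p => ⟪f p, g p⟫_ℂ)).2 (lp.hasSum_inner f g)
  exact h1.prod_fiberwise fun k => lp.hasSum_inner (fibre e f k) (fibre e g k)

/-- The function obtained by applying the operator `A` on each fibre. -/
def ampFun (A : H →L[ℂ] H) (f : HH) : ℕ × ℕ → ℂ :=
  fun p => A (fibre e f (e.symm p).1) (e.symm p).2

theorem ampFun_summable (A : H →L[ℂ] H) (f : HH) :
    Summable fun p => ‖ampFun e A f p‖ ^ 2 := by
  rw [← e.summable_iff, summable_prod_of_nonneg fun q =>
    show 0 ≤ ((fun p => ‖ampFun e A f p‖ ^ 2) ∘ e) q from sq_nonneg _]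
  refine ⟨fun k => by simpa [ampFun] using summable_sq (A (fibre e f k)), ?_⟩
  have h2 : ∀ k, ∑' n, ((fun p => ‖ampFun e A f p‖ ^ 2) ∘ e) (k, n)
      = ‖A (fibre e f k)‖ ^ 2 := by
    intro k
    rw [norm_sq_eq]
    simp [ampFun]
  simp_rw [h2]
  refine Summable.of_nonneg_of_le (fun _ => by positivity) (fun k => ?_)
    ((hasSum_fibre e f).summable.mul_left (‖A‖ ^ 2))
  rw [← mul_pow]
  exact pow_le_pow_left₀ (norm_nonneg _) (A.le_opNorm _) 2

/-- The operator on `l²(ℤ₊ × ℤ₊)` which acts as `A` on each fibre, as a vector valued map. -/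
def ampVec (A : H →L[ℂ] H) (f : HH) : HH := ⟨ampFun e A f, memlp_two (ampFun_summable e A f)⟩

theorem fibre_ampVec (A : H →L[ℂ] H) (f : HH) (k : κ) :
    fibre e (ampVec e A f) k = A (fibre e f k) := by
  ext n
  rw [fibre_apply]
  change ampFun e A f (e (k, n)) = _
  simp [ampFun]

theorem fibre_add (f g : HH) (k : κ) : fibre e (f + g) k = fibre e f k + fibre e g k := rfl

theorem fibre_smul (c : ℂ) (f : HH) (k : κ) : fibre e (c • f) k = c • fibre e f k := rfl

theorem norm_ampVec_le (A : H →L[ℂ] H) (f : HH) : ‖ampVec e A f‖ ≤ ‖A‖ * ‖f‖ := by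
  refine (sq_le_sq₀ (norm_nonneg _) (by positivity)).1 ?_
  rw [mul_pow]
  refine hasSum_le (fun k => ?_) (hasSum_fibre e (ampVec e A f))
    ((hasSum_fibre e f).mul_left (‖A‖ ^ 2))
  rw [fibre_ampVec, ← mul_pow]
  exact pow_le_pow_left₀ (norm_nonneg _) (A.le_opNorm _) 2

/-- The operator on `l²(ℤ₊ × ℤ₊)` which acts as `A` on each fibre. -/
def ampOp (A : H →L[ℂ] H) : HH →L[ℂ] HH :=
  LinearMap.mkContinuous
    { toFun := ampVec e A
      map_add' := fun f g => ext_fibre e fun k => by simp [fibre_ampVec, fibre_add]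
      map_smul' := fun c f => ext_fibre e fun k => by simp [fibre_ampVec, fibre_smul] }
    ‖A‖ (norm_ampVec_le e A)

theorem fibre_ampOp (A : H →L[ℂ] H) (f : HH) (k : κ) :
    fibre e (ampOp e A f) k = A (fibre e f k) := fibre_ampVec e A f k

theorem norm_ampOp_le (A : H →L[ℂ] H) : ‖ampOp e A‖ ≤ ‖A‖ :=
  LinearMap.mkContinuous_norm_le _ (norm_nonneg _) _

/-- The unital star homomorphism `B(l²(ℤ₊)) → B(l²(ℤ₊ × ℤ₊))` which lets an operator act on
each fibre `{e (k, n) | n ∈ ℤ₊}`. -/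
def amp : (H →L[ℂ] H) →⋆ₐ[ℂ] (HH →L[ℂ] HH) where
  toFun := ampOp e
  map_one' := ContinuousLinearMap.ext fun f => ext_fibre e fun k => by simp [fibre_ampOp]
  map_mul' A B := ContinuousLinearMap.ext fun f => ext_fibre e fun k => by simp [fibre_ampOp]
  map_zero' := ContinuousLinearMap.ext fun f => ext_fibre e fun k => by
    rw [fibre_ampOp]; rfl
  map_add' A B := ContinuousLinearMap.ext fun f => ext_fibre e fun k => by
    simp [fibre_ampOp, fibre_add]
  commutes' c := ContinuousLinearMap.ext fun f => ext_fibre e fun k => by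
    rw [fibre_ampOp]; simp [Algebra.algebraMap_eq_smul_one, fibre_smul]
  map_star' A := by
    rw [ContinuousLinearMap.star_eq_adjoint, ContinuousLinearMap.star_eq_adjoint,
      ContinuousLinearMap.eq_adjoint_iff]
    intro f g
    refine (hasSum_inner_fibre e _ g).unique ?_
    have h := hasSum_inner_fibre e f (ampOp e A g)
    simpa only [fibre_ampOp, ContinuousLinearMap.adjoint_inner_left] using h

theorem fibre_amp (A : H →L[ℂ] H) (f : HH) (k : κ) :
    fibre e (amp e A f) k = A (fibre e f k) := fibre_ampOp e A f k

theorem continuous_amp : Continuous (amp e) :=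
  AddMonoidHomClass.continuous_of_bound (amp e) 1 fun A => by
    rw [one_mul]; exact norm_ampOp_le e A

end Fibre

/-! ### The minimal tensor product `𝒯 ⊗ 𝒯` -/

/-- The operator `A ⊗ B` on `l²(ℤ₊) ⊗ l²(ℤ₊)`, as the product of `A ⊗ 1` (acting in the first
variable) and `1 ⊗ B` (acting in the second variable). -/
def tensorOp (A B : H →L[ℂ] H) : HH →L[ℂ] HH :=
  amp (Equiv.prodComm ℕ ℕ) A * amp (Equiv.refl (ℕ × ℕ)) B

/-- The minimal (spatial) C*-tensor product `𝒯 ⊗ 𝒯`: the norm closed star subalgebra of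
`B(l²(ℤ₊) ⊗ l²(ℤ₊))` generated by the operators `a ⊗ b`, `a, b ∈ 𝒯`. -/
def 𝒯𝒯 : StarSubalgebra ℂ (HH →L[ℂ] HH) :=
  (StarAlgebra.adjoin ℂ {X | ∃ a b : 𝒯, X = tensorOp a b}).topologicalClosure

theorem tensorOp_mem (a b : 𝒯) : tensorOp a b ∈ 𝒯𝒯 :=
  StarSubalgebra.le_topologicalClosure _ (StarAlgebra.subset_adjoin ℂ _ ⟨a, b, rfl⟩)

/-- The elementary tensor `a ⊗ b ∈ 𝒯 ⊗ 𝒯`. -/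
def tmul (a b : 𝒯) : 𝒯𝒯 := ⟨tensorOp a b, tensorOp_mem a b⟩

theorem tensorVec_hasSum (x y : H) :
    HasSum (fun p : ℕ × ℕ => ‖x p.1 * y p.2‖ ^ 2) (‖x‖ ^ 2 * ‖y‖ ^ 2) := by
  have h := (summable_sq x).mul_of_nonneg (summable_sq y)
    (fun _ => by positivity) (fun _ => by positivity)
  have h2 := (summable_sq x).hasSum.mul (summable_sq y).hasSum h
  rw [← norm_sq_eq, ← norm_sq_eq] at h2
  simpa only [norm_mul, mul_pow] using h2

/-- The vector `x ⊗ y ∈ l²(ℤ₊) ⊗ l²(ℤ₊)`. -/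
def tensorVec (x y : H) : HH :=
  ⟨fun p => x p.1 * y p.2, memlp_two (tensorVec_hasSum x y).summable⟩

theorem tensorVec_apply (x y : H) (p : ℕ × ℕ) : tensorVec x y p = x p.1 * y p.2 := rfl

theorem norm_tensorVec (x y : H) : ‖tensorVec x y‖ = ‖x‖ * ‖y‖ := by
  refine (sq_eq_sq₀ (norm_nonneg _) (by positivity)).1 ?_
  rw [mul_pow, norm_sq_eq]
  exact (tensorVec_hasSum x y).tsum_eq

theorem amp_snd_tensorVec (B : H →L[ℂ] H) (x y : H) :
    amp (Equiv.refl (ℕ × ℕ)) B (tensorVec x y) = tensorVec x (B y) := by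
  refine ext_fibre (Equiv.refl (ℕ × ℕ)) fun k => ?_
  have h : ∀ z : H, fibre (Equiv.refl (ℕ × ℕ)) (tensorVec x z) k = x k • z := fun z => rfl
  rw [fibre_amp, h, h, map_smul]

theorem amp_fst_tensorVec (A : H →L[ℂ] H) (x y : H) :
    amp (Equiv.prodComm ℕ ℕ) A (tensorVec x y) = tensorVec (A x) y := by
  refine ext_fibre (Equiv.prodComm ℕ ℕ) fun k => ?_
  have h : ∀ z : H, fibre (Equiv.prodComm ℕ ℕ) (tensorVec z y) k = y k • z := by
    intro z
    ext n
    exact mul_comm _ _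
  rw [fibre_amp, h, h, map_smul]

/-- The operators `A ⊗ B` are the usual ones: `(A ⊗ B) (x ⊗ y) = Ax ⊗ By`. -/
theorem tensorOp_tensorVec (A B : H →L[ℂ] H) (x y : H) :
    tensorOp A B (tensorVec x y) = tensorVec (A x) (B y) := by
  rw [tensorOp, mul_apply_eq_comp, amp_snd_tensorVec, amp_fst_tensorVec]

theorem ext_tensorVec {X Y : HH →L[ℂ] HH}
    (h : ∀ x y, X (tensorVec x y) = Y (tensorVec x y)) : X = Y := by
  refine lp.ext_continuousLinearMap (by norm_num) fun p => ContinuousLinearMap.ext_ring ?_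
  have hp : lp.single (E := fun _ : ℕ × ℕ => ℂ) 2 p (1 : ℂ)
      = tensorVec (lp.single 2 p.1 1) (lp.single 2 p.2 1) := by
    ext q
    rw [tensorVec_apply, lp.single_apply, lp.single_apply, lp.single_apply]
    simp only [Pi.single_apply, Prod.ext_iff]
    split_ifs <;> simp_all
  change X (lp.single 2 p 1) = Y (lp.single 2 p 1)
  rw [hp, h]

/-! ### The tensor product of two functionals -/

/-- The operator `y ↦ x ⊗ y`, linearly in `x`. -/
def tensorVecL : H →L[ℂ] H →L[ℂ] HH :=
  LinearMap.mkContinuous₂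
    (LinearMap.mk₂ ℂ tensorVec
      (fun x x' y => by ext p; exact add_mul _ _ _)
      (fun c x y => by ext p; exact mul_assoc _ _ _)
      (fun x y y' => by ext p; exact mul_add _ _ _)
      (fun c x y => by ext p; exact mul_left_comm _ _ _)) 1
    (fun x y => by rw [one_mul]; exact (norm_tensorVec x y).le)

theorem tensorVecL_apply (x y : H) : tensorVecL x y = tensorVec x y := rfl

theorem norm_tensorVecL_le (x : H) : ‖tensorVecL x‖ ≤ ‖x‖ :=
  ContinuousLinearMap.opNorm_le_bound _ (norm_nonneg _) fun y => by
    rw [tensorVecL_apply, norm_tensorVec]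

/-- The slice `(⟨v, · w⟩ ⊗ id) X ∈ B(l²(ℤ₊))` of an operator `X` on `l²(ℤ₊) ⊗ l²(ℤ₊)`. -/
def vecSlice (X : HH →L[ℂ] HH) (v w : H) : H →L[ℂ] H :=
  ContinuousLinearMap.adjoint (tensorVecL v) ∘L X ∘L tensorVecL w

theorem norm_vecSlice_le (X : HH →L[ℂ] HH) (v w : H) :
    ‖vecSlice X v w‖ ≤ ‖X‖ * ‖w‖ * ‖v‖ := by
  refine (ContinuousLinearMap.opNorm_comp_le _ _).trans ?_
  rw [LinearIsometryEquiv.norm_map, mul_comm]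
  refine mul_le_mul ((ContinuousLinearMap.opNorm_comp_le _ _).trans ?_)
    (norm_tensorVecL_le v) (norm_nonneg _) (by positivity)
  exact mul_le_mul_of_nonneg_left (norm_tensorVecL_le w) (norm_nonneg _)

theorem inner_tensorVec (v z x y : H) :
    ⟪tensorVec v z, tensorVec x y⟫_ℂ = ⟪v, x⟫_ℂ * ⟪z, y⟫_ℂ := by
  refine (hasSum_inner_fibre (Equiv.refl (ℕ × ℕ)) _ _).unique ?_
  have h : ∀ (x y : H) k, fibre (Equiv.refl (ℕ × ℕ)) (tensorVec x y) k = x k • y :=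
    fun x y k => rfl
  have h2 := (lp.hasSum_inner v x).mul_right ⟪z, y⟫_ℂ
  have h3 : ∀ k, ⟪fibre (Equiv.refl (ℕ × ℕ)) (tensorVec v z) k,
      fibre (Equiv.refl (ℕ × ℕ)) (tensorVec x y) k⟫_ℂ = ⟪v k, x k⟫_ℂ * ⟪z, y⟫_ℂ := by
    intro k
    rw [h, h, inner_smul_left, inner_smul_right, ← mul_assoc]
    congr 1
    exact mul_comm _ _
  simp_rw [h3]
  exact h2

theorem vecSlice_tensorOp (A B : H →L[ℂ] H) (v w : H) :
    vecSlice (tensorOp A B) v w = ⟪v, A w⟫_ℂ • B := by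
  ext1 y
  refine ext_inner_left ℂ fun z => ?_
  simp only [vecSlice, ContinuousLinearMap.comp_apply, ContinuousLinearMap.adjoint_inner_right,
    tensorVecL_apply, tensorOp_tensorVec, inner_tensorVec]
  exact (inner_smul_right _ _ _).symm

section Slice

variable (φ : StrongDual ℂ (H →L[ℂ] H))

/-- The functional `v ↦ conj (φ ((⟨v, · w⟩ ⊗ id) X))`. -/
def sliceForm (X : HH →L[ℂ] HH) (w : H) : StrongDual ℂ H :=
  LinearMap.mkContinuous
    { toFun := fun v => conj (φ (vecSlice X v w))
      map_add' := fun v v' => by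
        simp only [vecSlice, map_add, ContinuousLinearMap.add_comp]
      map_smul' := fun c v => by
        simp only [vecSlice, map_smul, map_smulₛₗ, ContinuousLinearMap.smul_comp, smul_eq_mul,
          map_mul, Complex.conj_conj, RingHom.id_apply] }
    (‖φ‖ * (‖X‖ * ‖w‖)) (fun v => by
      change ‖conj (φ (vecSlice X v w))‖ ≤ _
      rw [RCLike.norm_conj, mul_assoc]
      exact φ.le_opNorm_of_le (norm_vecSlice_le X v w))

theorem sliceForm_apply (X : HH →L[ℂ] HH) (v w : H) :
    sliceForm φ X w v = conj (φ (vecSlice X v w)) := rfl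

/-- The vector `((id ⊗ φ) X) w`. -/
def sliceVec (X : HH →L[ℂ] HH) (w : H) : H := (InnerProductSpace.toDual ℂ H).symm (sliceForm φ X w)

theorem inner_sliceVec (X : HH →L[ℂ] HH) (v w : H) :
    ⟪v, sliceVec φ X w⟫_ℂ = φ (vecSlice X v w) := by
  rw [← inner_conj_symm, sliceVec, InnerProductSpace.toDual_symm_apply, sliceForm_apply,
    Complex.conj_conj]

theorem norm_sliceVec_le (X : HH →L[ℂ] HH) (w : H) :
    ‖sliceVec φ X w‖ ≤ ‖φ‖ * ‖X‖ * ‖w‖ := by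
  rw [sliceVec, LinearIsometryEquiv.norm_map, mul_assoc]
  exact LinearMap.mkContinuous_norm_le _ (by positivity) _

/-- The slice map `id ⊗ φ : B(l²(ℤ₊) ⊗ l²(ℤ₊)) → B(l²(ℤ₊))`. -/
def slice : (HH →L[ℂ] HH) →L[ℂ] H →L[ℂ] H :=
  LinearMap.mkContinuous₂
    (LinearMap.mk₂ ℂ (sliceVec φ)
      (fun X X' w => ext_inner_left ℂ fun v => by
        simp only [inner_add_right, inner_sliceVec, vecSlice, ContinuousLinearMap.add_comp,
          ContinuousLinearMap.comp_add, map_add])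
      (fun c X w => ext_inner_left ℂ fun v => by
        simp only [inner_smul_right, inner_sliceVec, vecSlice, ContinuousLinearMap.smul_comp,
          ContinuousLinearMap.comp_smul, map_smul, smul_eq_mul])
      (fun X w w' => ext_inner_left ℂ fun v => by
        simp only [inner_add_right, inner_sliceVec, vecSlice, ContinuousLinearMap.comp_add,
          map_add])
      (fun c X w => ext_inner_left ℂ fun v => by
        simp only [inner_smul_right, inner_sliceVec, vecSlice, ContinuousLinearMap.comp_smul,
          map_smul, smul_eq_mul])) ‖φ‖
    (fun X w => norm_sliceVec_le φ X w)

theorem slice_tensorOp (A B : H →L[ℂ] H) : slice φ (tensorOp A B) = φ B • A := by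
  ext1 w
  refine ext_inner_left ℂ fun v => ?_
  have h : ⟪v, slice φ (tensorOp A B) w⟫_ℂ = φ (vecSlice (tensorOp A B) v w) :=
    inner_sliceVec φ _ _ _
  rw [h, vecSlice_tensorOp, map_smul, smul_eq_mul, mul_comm]
  exact (inner_smul_right _ _ _).symm

theorem norm_slice_le : ‖slice φ‖ ≤ ‖φ‖ :=
  LinearMap.mkContinuous₂_norm_le _ (norm_nonneg φ) _

end Slice

/-- For `ρ, φ ∈ 𝒯*` there is a bounded functional on `𝒯 ⊗ 𝒯` with `a ⊗ b ↦ ρ a * φ b`. -/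
theorem exists_tensorFunctional (ρ φ : Dual𝒯) :
    ∃ F : StrongDual ℂ 𝒯𝒯, (∀ a b, F (tmul a b) = ρ a * φ b) ∧ ‖F‖ ≤ ‖ρ‖ * ‖φ‖ := by
  obtain ⟨ρ', h1, h2⟩ := exists_extension_norm_eq (𝕜 := ℂ) 𝒯.toSubalgebra.toSubmodule ρ
  obtain ⟨φ', h3, h4⟩ := exists_extension_norm_eq (𝕜 := ℂ) 𝒯.toSubalgebra.toSubmodule φ
  refine ⟨(ρ' ∘L slice φ') ∘L 𝒯𝒯.toSubalgebra.toSubmodule.subtypeL, fun a b => ?_, ?_⟩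
  · change ρ' (slice φ' (tensorOp a b)) = _
    rw [slice_tensorOp, map_smul, smul_eq_mul, mul_comm]
    exact congrArg₂ _ (h1 a) (h3 b)
  · refine ContinuousLinearMap.opNorm_le_bound _ (mul_nonneg (norm_nonneg ρ) (norm_nonneg φ))
      fun X => ?_
    change ‖ρ' (slice φ' (X : HH →L[ℂ] HH))‖ ≤ ‖ρ‖ * ‖φ‖ * ‖(X : HH →L[ℂ] HH)‖
    rw [mul_assoc]
    refine (ρ'.le_opNorm_of_le ((slice φ').le_of_opNorm_le (norm_slice_le φ') _)).trans ?_
    rw [h2, h4]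
    exact le_rfl

/-- The functional `ρ ⊗ φ` on `𝒯 ⊗ 𝒯`: the bounded functional with `a ⊗ b ↦ ρ a * φ b`. -/
def tensorFunctional (ρ φ : Dual𝒯) : StrongDual ℂ 𝒯𝒯 :=
  (exists_tensorFunctional ρ φ).choose

theorem tensorFunctional_tmul (ρ φ : Dual𝒯) (a b : 𝒯) :
    tensorFunctional ρ φ (tmul a b) = ρ a * φ b :=
  (exists_tensorFunctional ρ φ).choose_spec.1 a b

theorem norm_tensorFunctional_le (ρ φ : Dual𝒯) : ‖tensorFunctional ρ φ‖ ≤ ‖ρ‖ * ‖φ‖ :=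
  (exists_tensorFunctional ρ φ).choose_spec.2

theorem tensorOp_mul (A B A' B' : H →L[ℂ] H) :
    tensorOp A B * tensorOp A' B' = tensorOp (A * A') (B * B') :=
  ext_tensorVec fun x y => by
    simp only [mul_apply_eq_comp, tensorOp_tensorVec]

theorem tensorOp_star (A B : H →L[ℂ] H) :
    star (tensorOp A B) = tensorOp (star A) (star B) :=
  ext_tensorVec fun x y => by
    rw [tensorOp_tensorVec, tensorOp, star_mul, ← map_star, ← map_star, mul_apply_eq_comp,
      amp_fst_tensorVec, amp_snd_tensorVec]

theorem tensorOp_one : tensorOp 1 1 = 1 :=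
  ext_tensorVec fun x y => by rw [tensorOp_tensorVec]; rfl

/-- Bounded functionals on `𝒯 ⊗ 𝒯` are determined by their values on elementary tensors. -/
theorem ext_tmul {F G : StrongDual ℂ 𝒯𝒯} (h : ∀ a b, F (tmul a b) = G (tmul a b)) : F = G := by
  let S : Submonoid (HH →L[ℂ] HH) :=
    { carrier := {X | ∃ a b : 𝒯, X = tensorOp a b}
      one_mem' := ⟨1, 1, tensorOp_one.symm⟩
      mul_mem' := by
        rintro _ _ ⟨a, b, rfl⟩ ⟨c, d, rfl⟩
        exact ⟨a * c, b * d, tensorOp_mul _ _ _ _⟩ }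
  have hS : {X | ∃ a b : 𝒯, X = tensorOp a b} ∪ star {X | ∃ a b : 𝒯, X = tensorOp a b}
      = (S : Set (HH →L[ℂ] HH)) := by
    refine Set.union_eq_left.2 ?_
    rintro X ⟨a, b, hX⟩
    exact ⟨star a, star b, by rw [← star_star X, hX, tensorOp_star]; rfl⟩
  have hcl : IsClosed (Subtype.val '' {X : 𝒯𝒯 | F X = G X}) :=
    (StarSubalgebra.isClosed_topologicalClosure _).isClosedMap_subtype_val _
      (isClosed_eq F.continuous G.continuous)
  have hsub : ∀ X ∈ StarAlgebra.adjoin ℂ {X | ∃ a b : 𝒯, X = tensorOp a b},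
      X ∈ Subtype.val '' {X : 𝒯𝒯 | F X = G X} := by
    intro X hX
    replace hX : X ∈ Submodule.span ℂ (S : Set (HH →L[ℂ] HH)) := by
      have h2 := StarAlgebra.adjoin_eq_span (R := ℂ) {X | ∃ a b : 𝒯, X = tensorOp a b}
      rw [hS, Submonoid.closure_eq] at h2
      rw [← h2]
      exact hX
    induction hX using Submodule.span_induction with
    | mem X hX =>
      obtain ⟨a, b, rfl⟩ := hX
      exact ⟨tmul a b, h a b, rfl⟩
    | zero => exact ⟨0, by simp, rfl⟩
    | add X Y _ _ h1 h2 =>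
      obtain ⟨X, hX, rfl⟩ := h1
      obtain ⟨Y, hY, rfl⟩ := h2
      refine ⟨X + Y, ?_, rfl⟩
      change F (X + Y) = G (X + Y)
      rw [map_add, map_add]
      exact congrArg₂ _ hX hY
    | smul c X _ h1 =>
      obtain ⟨X, hX, rfl⟩ := h1
      refine ⟨c • X, ?_, rfl⟩
      change F (c • X) = G (c • X)
      rw [map_smul, map_smul]
      exact congrArg _ hX
  ext ⟨X, hX⟩
  obtain ⟨Y, hY, hYX⟩ := closure_minimal hsub hcl hX
  obtain rfl : Y = ⟨X, hX⟩ := Subtype.ext hYX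
  exact hY

/-! ### The comultiplication -/

/-- The decomposition of `ℤ₊ × ℤ₊` into diagonals: `(d, n) ↦ (n + d⁺, n + d⁻)`. -/
def diagEquiv : ℤ × ℕ ≃ ℕ × ℕ where
  toFun q := (q.2 + q.1.toNat, q.2 + (-q.1).toNat)
  invFun p := ((p.1 : ℤ) - p.2, min p.1 p.2)
  left_inv q := by
    ext <;> dsimp only <;> omega
  right_inv p := by
    ext <;> dsimp only <;> omega

theorem amp_diag_shift : amp diagEquiv shift = tensorOp shift shift := by
  refine ext_tensorVec fun x y => ext_fibre diagEquiv fun k => ?_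
  rw [tensorOp_tensorVec, fibre_amp]
  ext n
  rw [shift_apply, fibre_apply, tensorVec_apply, shift_apply, shift_apply]
  cases n with
  | zero =>
    change 0 = shiftFun x (0 + k.toNat) * shiftFun y (0 + (-k).toNat)
    rcases le_total k 0 with hk | hk
    · rw [Int.toNat_of_nonpos hk]
      exact (zero_mul _).symm
    · rw [Int.toNat_of_nonpos (neg_nonpos.2 hk)]
      exact (mul_zero _).symm
  | succ n =>
    change x (n + k.toNat) * y (n + (-k).toNat)
      = shiftFun x (n + 1 + k.toNat) * shiftFun y (n + 1 + (-k).toNat)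
    rw [add_right_comm n 1, add_right_comm n 1]
    rfl

theorem amp_diag_mem (a : 𝒯) : amp diagEquiv a ∈ 𝒯𝒯 := by
  have h : 𝒯 ≤ 𝒯𝒯.comap (amp diagEquiv) := by
    refine StarAlgebra.elemental.le_of_mem ?_ ?_
    · exact (StarSubalgebra.isClosed_topologicalClosure _).preimage (continuous_amp diagEquiv)
    · change amp diagEquiv shift ∈ 𝒯𝒯
      rw [amp_diag_shift]
      exact tensorOp_mem genT genT
  exact h a.2

/-- The comultiplication `Δ : 𝒯 → 𝒯 ⊗ 𝒯`: the unital star homomorphism with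
`Δ(T) = T ⊗ T` (see `comul_genT`), which is unique since `T` generates `𝒯` (see `comul_unique`).
The operator `T ⊗ T` moves `(i, j)` to `(i + 1, j + 1)`, i.e. it acts as a copy of the shift on
each diagonal of `ℤ₊ × ℤ₊`, and `Δ(A)` acts as a copy of `A` on each diagonal. -/
def comul : 𝒯 →⋆ₐ[ℂ] 𝒯𝒯 :=
  StarAlgHom.codRestrict ((amp diagEquiv).comp 𝒯.subtype) 𝒯𝒯 amp_diag_mem

theorem continuous_comul : Continuous comul :=
  ((continuous_amp diagEquiv).comp continuous_subtype_val).subtype_mk _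

theorem comul_genT : comul genT = tmul genT genT := Subtype.ext amp_diag_shift

theorem comul_unique (D : 𝒯 →⋆ₐ[ℂ] 𝒯𝒯) (hc : Continuous D) (hD : D genT = tmul genT genT) :
    D = comul :=
  StarAlgebra.elemental.starAlgHomClass_ext ℂ hc continuous_comul (hD.trans comul_genT.symm)

theorem comul_T (n m : ℕ) : comul (T n m) = tmul (T n m) (T n m) := by
  have hmul : ∀ a b c d : 𝒯, tmul a b * tmul c d = tmul (a * c) (b * d) :=
    fun a b c d => Subtype.ext (tensorOp_mul _ _ _ _)
  have hstar : ∀ a b : 𝒯, star (tmul a b) = tmul (star a) (star b) :=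
    fun a b => Subtype.ext (tensorOp_star _ _)
  have hpow : ∀ (a : 𝒯) (k : ℕ), tmul a a ^ k = tmul (a ^ k) (a ^ k) := by
    intro a k
    induction k with
    | zero => exact Subtype.ext tensorOp_one.symm
    | succ k ih => rw [pow_succ, ih, hmul, ← pow_succ]
  rw [T, map_mul, map_pow, map_pow, map_star, comul_genT, hstar, hpow, hpow, hmul]

/-- `Δ` as a bounded linear map. -/
def comulL : 𝒯 →L[ℂ] 𝒯𝒯 := ⟨comul.toAlgHom.toLinearMap, continuous_comul⟩

/-! ### The dual algebra -/

/-- The product of functionals: `(ρ ∗ φ)(A) = (ρ ⊗ φ)(Δ(A))`. -/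
def conv (ρ φ : Dual𝒯) : Dual𝒯 := (tensorFunctional ρ φ).comp comulL

theorem conv_apply (ρ φ : Dual𝒯) (a : 𝒯) :
    conv ρ φ a = tensorFunctional ρ φ (comul a) := rfl

/-- The convolution powers: `convPowSucc ρ n = ρ^{∗(n+1)}`, the product of `n + 1` factors `ρ`. -/
def convPowSucc (ρ : Dual𝒯) : ℕ → Dual𝒯
  | 0 => ρ
  | n + 1 => conv (convPowSucc ρ n) ρ

/-- The Cesàro means `ρₙ = (1/n) ∑_{k=1}^n ρ^{∗k}`, for `n ≥ 1`. The summation index is shifted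
by one: the `k`-th summand below is `ρ^{∗(k+1)}`. -/
def cesaro (ρ : Dual𝒯) (n : ℕ) : Dual𝒯 :=
  (n : ℂ)⁻¹ • ∑ k ∈ Finset.range n, convPowSucc ρ k

/-- States: positive functionals of value `1` at the unit. -/
def IsState (ρ : Dual𝒯) : Prop := (∀ a : 𝒯, 0 ≤ ρ (star a * a)) ∧ ρ 1 = 1

/-- Faithfulness of a functional: `ρ(a*a) = 0` only for `a = 0`. -/
def IsFaithful (ρ : Dual𝒯) : Prop := ∀ a : 𝒯, ρ (star a * a) = 0 → a = 0

/-- Haar functionals in `𝒯*`: states `h` such that `h ∗ ρ = ρ ∗ h = λ_ρ h` for every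
`ρ ∈ 𝒯*`, with a scalar `λ_ρ`. -/
def IsHaarFunctional (h : Dual𝒯) : Prop :=
  IsState h ∧ ∀ ρ : Dual𝒯, ∃ c : ℂ, conv h ρ = c • h ∧ conv ρ h = c • h

end Toeplitz

end

noncomputable section

namespace Toeplitz

/-! The span of the `T n m` is dense and `Δ` sends `T n m` to `T n m ⊗ T n m`, so a functional is
determined by the array of its values on the `T n m`, and convolution multiplies these arrays
entrywise (`ext_T`, `conv_T`). The Haar functional is the vector state of `e₀`, whose array is the
indicator of `(0, 0)`.

For a faithful state, Cauchy–Schwarz bounds `|ρ(T n m)|²` by `ρ(T n n) ρ(T m m)`, and `ρ(T n n) < 1`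
for `n ≠ 0` because `1 - T n n` is a nonzero projection. Hence the convolution powers converge to
the Haar functional entry by entry.

Norm convergence needs more. With `Q = T n n` and `P = 1 - Q`, put `τ(A) = ρ(A) - ρ(PAP) = ρ(QAQ) +
ρ(PAQ) + ρ(QAP)`. If `c` is the limit of the decreasing sequence `ρ(T m m)`, then `‖τ‖ ≤ ρ(Q) +
2√(ρ(Q) - c)` (`IsState.norm_sub_compression_le`), and the right side tends to `c < 1` as `n → ∞`.
So `‖τ‖ < 1` for some `n`, and the convolution powers of `τ` tend to zero in norm. Compression by
`P` kills `T a b` unless `a, b < n`, so the powers of `ρ` and of `τ` differ by functionals in a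
fixed finite-dimensional space, where entrywise convergence is norm convergence. Thus the powers
themselves converge in norm, and so do their means. -/

/-! ### Cauchy–Schwarz for states -/

/-- The Cauchy–Schwarz inequality in the GNS space of a positive functional. -/
theorem norm_positive_apply_le {A : Type*} [CStarAlgebra A] (ρ : A →ₗ[ℂ] ℂ)
    (hρ : ∀ a, 0 ≤ ρ (star a * a)) (x a y : A) :
    ‖ρ (star x * a * y)‖ ≤
      ‖a‖ * (√(ρ (star x * x)).re * √(ρ (star y * y)).re) := by
  -- In the spectral order the nonnegative elements are exactly the `star b * b`, so `hρ` is
  -- positivity of `ρ`.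
  let := CStarAlgebra.spectralOrder A
  have := CStarAlgebra.spectralOrderedRing A
  let f : A →ₚ[ℂ] ℂ := PositiveLinearMap.mk₀ ρ fun a ha => by
    obtain ⟨b, rfl⟩ := CStarAlgebra.nonneg_iff_eq_star_mul_self.1 ha
    exact hρ b
  have h := norm_inner_le_norm (𝕜 := ℂ) (f.toPreGNS x) (f.leftMulMapPreGNS a (f.toPreGNS y))
  have h2 : ‖f.leftMulMapPreGNS a (f.toPreGNS y)‖ ≤ ‖a‖ * ‖f.toPreGNS y‖ :=
    ContinuousLinearMap.le_of_opNorm_le _ (LinearMap.mkContinuous_norm_le _ (norm_nonneg _) _) _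
  rw [PositiveLinearMap.preGNS_inner_def] at h
  have e : f (star (f.ofPreGNS (f.toPreGNS x)) * f.ofPreGNS (f.leftMulMapPreGNS a (f.toPreGNS y)))
    = ρ (star x * a * y) := by rw [mul_assoc]; rfl
  rw [e] at h
  refine (h.trans (mul_le_mul_of_nonneg_left h2 (norm_nonneg _))).trans (le_of_eq ?_)
  rw [PositiveLinearMap.preGNS_norm_def, PositiveLinearMap.preGNS_norm_def, mul_left_comm]
  rfl

theorem isClosed_toeplitz : IsClosed (𝒯 : Set (H →L[ℂ] H)) :=
  StarSubalgebra.isClosed_topologicalClosure _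

theorem norm_state_le {ρ : Dual𝒯} (hρ : IsState ρ) (x a y : 𝒯) :
    ‖ρ (star x * a * y)‖ ≤
      ‖a‖ * (√(ρ (star x * x)).re * √(ρ (star y * y)).re) := by
  -- Completeness is inherited from `B(H)`, since `𝒯` is closed.
  let : CStarAlgebra 𝒯 := { toCompleteSpace := isClosed_toeplitz.completeSpace_coe }
  exact norm_positive_apply_le (ρ : 𝒯 →ₗ[ℂ] ℂ) hρ.1 x a y

/-! ### The generators -/

theorem norm_shift_apply (f : H) : ‖shift f‖ = ‖f‖ := by
  refine (sq_eq_sq₀ (norm_nonneg _) (norm_nonneg _)).1 ?_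
  rw [norm_sq_eq, norm_sq_eq]
  change ∑' i, ‖shiftFun f i‖ ^ 2 = _
  rw [(shiftFun_summable f).tsum_eq_zero_add]
  simp [shiftFun]

theorem star_shift_mul_shift : star shift * shift = 1 :=
  (ContinuousLinearMap.norm_map_iff_adjoint_comp_self shift).1 norm_shift_apply

theorem star_genT_mul_genT : star genT * genT = 1 := Subtype.ext star_shift_mul_shift

theorem star_pow_mul_pow_self (n : ℕ) : star genT ^ n * genT ^ n = 1 := by
  induction n with
  | zero => simp
  | succ n ih =>
    rw [pow_succ, pow_succ', mul_assoc, ← mul_assoc (star genT) genT, star_genT_mul_genT, one_mul,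
      ih]

theorem star_pow_mul_pow_of_le {n m : ℕ} (h : n ≤ m) :
    star genT ^ n * genT ^ m = genT ^ (m - n) := by
  obtain ⟨k, rfl⟩ := Nat.exists_eq_add_of_le h
  rw [pow_add, ← mul_assoc, star_pow_mul_pow_self, one_mul, Nat.add_sub_cancel_left]

theorem star_pow_mul_pow_of_ge {n m : ℕ} (h : m ≤ n) :
    star genT ^ n * genT ^ m = star genT ^ (n - m) := by
  obtain ⟨k, rfl⟩ := Nat.exists_eq_add_of_le h
  rw [add_comm, pow_add, mul_assoc, star_pow_mul_pow_self, mul_one, Nat.add_sub_cancel]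

theorem star_T (n m : ℕ) : star (T n m) = T m n := by
  simp [T]

theorem T_zero_zero : T 0 0 = 1 := by simp [T]

/-- The inner factor `T*ᵇTᶜ` collapses to a power of `T` or of `T*`. This makes the span of the `T n
m` an algebra. -/
theorem T_mul_T (a b c d : ℕ) : ∃ n m, T a b * T c d = T n m := by
  have e : T a b * T c d = genT ^ a * (star genT ^ b * genT ^ c) * star genT ^ d := by
    simp only [T, mul_assoc]
  rcases le_total b c with h | h
  · refine ⟨a + (c - b), d, ?_⟩
    rw [e, star_pow_mul_pow_of_le h, ← pow_add, T]
  · refine ⟨a, (b - c) + d, ?_⟩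
    rw [e, star_pow_mul_pow_of_ge h, mul_assoc, ← pow_add, T]

theorem T_mul_T_self {b m : ℕ} (a : ℕ) (h : b ≤ m) :
    T a b * T m m = T (a + (m - b)) m := by
  have e : T a b * T m m = genT ^ a * (star genT ^ b * genT ^ m) * star genT ^ m := by
    simp only [T, mul_assoc]
  rw [e, star_pow_mul_pow_of_le h, ← pow_add, T]

theorem T_self_mul_T {a n : ℕ} (b : ℕ) (h : n ≤ a) : T n n * T a b = T a b := by
  have e : T n n * T a b = genT ^ n * (star genT ^ n * genT ^ a) * star genT ^ b := by
    simp only [T, mul_assoc]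
  rw [e, star_pow_mul_pow_of_le h, ← pow_add, Nat.add_sub_cancel' h, T]

theorem T_self_mul_T_self (n : ℕ) : T n n * T n n = T n n := T_self_mul_T n le_rfl

/-- The linear span of the operators `T_{n,m}`. -/
def spanT : Submodule ℂ 𝒯 := Submodule.span ℂ {a | ∃ n m, a = T n m}

theorem T_mem_spanT (n m : ℕ) : T n m ∈ spanT := Submodule.subset_span ⟨n, m, rfl⟩

theorem mul_mem_spanT {a b : 𝒯} (ha : a ∈ spanT) (hb : b ∈ spanT) : a * b ∈ spanT := by
  have h : spanT * spanT ≤ spanT := by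
    rw [spanT, Submodule.span_mul_span]
    refine Submodule.span_mono ?_
    rintro _ ⟨_, ⟨n, m, rfl⟩, _, ⟨k, l, rfl⟩, rfl⟩
    exact T_mul_T n m k l
  exact h (Submodule.mul_mem_mul ha hb)

theorem star_mem_spanT {a : 𝒯} (ha : a ∈ spanT) : star a ∈ spanT := by
  induction ha using Submodule.span_induction with
  | mem a ha =>
    obtain ⟨n, m, rfl⟩ := ha
    rw [star_T]
    exact T_mem_spanT m n
  | zero => rw [star_zero]; exact zero_mem _
  | add a b _ _ h1 h2 => rw [star_add]; exact add_mem h1 h2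
  | smul c a _ h => rw [star_smul]; exact Submodule.smul_mem _ _ h

/-- The span of the operators `T_{n,m}` as a star subalgebra. -/
def spanTAlg : StarSubalgebra ℂ 𝒯 where
  carrier := spanT
  mul_mem' := mul_mem_spanT
  add_mem' := add_mem
  algebraMap_mem' c := by
    rw [Algebra.algebraMap_eq_smul_one, ← T_zero_zero]
    exact Submodule.smul_mem _ _ (T_mem_spanT 0 0)
  star_mem' := star_mem_spanT

/-- The closure of the span is a closed star subalgebra containing the shift, hence is all of `𝒯`.
-/
theorem mem_closure_spanT (a : 𝒯) : a ∈ closure (spanT : Set 𝒯) := by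
  let S := spanTAlg.topologicalClosure.map 𝒯.subtype
  have hcl : IsClosed (S : Set (H →L[ℂ] H)) :=
    isClosed_toeplitz.isClosedMap_subtype_val _
      (StarSubalgebra.isClosed_topologicalClosure spanTAlg)
  have hT : shift ∈ S := by
    refine ⟨genT, StarSubalgebra.le_topologicalClosure _ ?_, rfl⟩
    have : T 1 0 ∈ spanT := T_mem_spanT 1 0
    change genT ∈ spanT
    simpa [T] using this
  obtain ⟨b, hb, hba⟩ := StarAlgebra.elemental.le_of_mem hcl hT a.2
  obtain rfl : b = a := Subtype.ext hba
  exact hb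

theorem ext_T {f g : Dual𝒯} (h : ∀ n m, f (T n m) = g (T n m)) : f = g := by
  ext a
  refine closure_minimal (s := (spanT : Set 𝒯)) (t := {a | f a = g a}) ?_
    (isClosed_eq f.continuous g.continuous) (mem_closure_spanT a)
  intro b hb
  refine LinearMap.eqOn_span (f := (f : 𝒯 →ₗ[ℂ] ℂ)) (g := (g : 𝒯 →ₗ[ℂ] ℂ)) ?_ hb
  rintro _ ⟨n, m, rfl⟩
  exact h n m

/-! ### Convolution -/

theorem conv_T (ρ φ : Dual𝒯) (n m : ℕ) : conv ρ φ (T n m) = ρ (T n m) * φ (T n m) := by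
  rw [conv_apply, comul_T, tensorFunctional_tmul]

/-- Both `Δ` and the slice maps respect norms. It makes the convolution powers of a functional of
norm below one decay geometrically. -/
theorem norm_conv_le (ρ φ : Dual𝒯) : ‖conv ρ φ‖ ≤ ‖ρ‖ * ‖φ‖ := by
  refine ContinuousLinearMap.opNorm_le_bound _ (by positivity) fun a => ?_
  exact (tensorFunctional ρ φ).le_of_opNorm_le_of_le (norm_tensorFunctional_le ρ φ)
    (norm_ampOp_le diagEquiv a)

theorem convPowSucc_T (ρ : Dual𝒯) (k n m : ℕ) :
    convPowSucc ρ k (T n m) = ρ (T n m) ^ (k + 1) := by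
  induction k with
  | zero => simp [convPowSucc]
  | succ k ih => rw [convPowSucc, conv_T, ih, pow_succ _ (k + 1)]

theorem norm_convPowSucc_le (ρ : Dual𝒯) (k : ℕ) : ‖convPowSucc ρ k‖ ≤ ‖ρ‖ ^ (k + 1) := by
  induction k with
  | zero => simp [convPowSucc]
  | succ k ih =>
    rw [pow_succ]
    exact (norm_conv_le _ _).trans (mul_le_mul_of_nonneg_right ih (norm_nonneg ρ))

/-! ### Matrix coefficients -/

/-- The basis vector `eₙ`. -/
def basisVec (n : ℕ) : H := lp.single 2 n 1

theorem inner_basisVec (n m : ℕ) : ⟪basisVec n, basisVec m⟫_ℂ = if n = m then 1 else 0 := by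
  rw [basisVec, lp.inner_single_left, basisVec, lp.single_apply]
  by_cases h : n = m
  · subst h; simp
  · simp [h]

theorem shift_basisVec (n : ℕ) : shift (basisVec n) = basisVec (n + 1) := by
  ext i
  rw [shift_apply]
  cases i with
  | zero => simp [shiftFun, basisVec, lp.single_apply]
  | succ i => simp [shiftFun, basisVec, lp.single_apply, Pi.single_apply]

theorem star_shift_basisVec_succ (n : ℕ) : star shift (basisVec (n + 1)) = basisVec n := by
  rw [← shift_basisVec, ← mul_apply_eq_comp, star_shift_mul_shift]
  rfl

theorem star_shift_basisVec_zero : star shift (basisVec 0) = 0 := by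
  refine ext_inner_right ℂ fun y => ?_
  rw [ContinuousLinearMap.star_eq_adjoint, ContinuousLinearMap.adjoint_inner_left, basisVec,
    lp.inner_single_left, shift_apply, inner_zero_left]
  exact inner_zero_right _

theorem star_shift_pow_basisVec (k n : ℕ) :
    (star shift ^ k) (basisVec n) = if k ≤ n then basisVec (n - k) else 0 := by
  induction k generalizing n with
  | zero => simp
  | succ k ih =>
    rw [pow_succ, mul_apply_eq_comp]
    cases n with
    | zero => simp [star_shift_basisVec_zero]
    | succ n => simp [star_shift_basisVec_succ, ih]

/-- The functional `A ↦ ⟨eᵢ, A eⱼ⟩`. -/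
def matrixCoeff (i j : ℕ) : Dual𝒯 :=
  (innerSL ℂ (basisVec i)) ∘L (ContinuousLinearMap.apply ℂ H (basisVec j)) ∘L
    𝒯.toSubalgebra.toSubmodule.subtypeL

theorem matrixCoeff_apply (i j : ℕ) (a : 𝒯) :
    matrixCoeff i j a = ⟪basisVec i, (a : H →L[ℂ] H) (basisVec j)⟫_ℂ := rfl

theorem matrixCoeff_T (i j n m : ℕ) :
    matrixCoeff i j (T n m) = if n ≤ i ∧ m ≤ j ∧ i - n = j - m then 1 else 0 := by
  -- In this form the coefficient is the inner product of `T*ⁿ eᵢ` and `T*ᵐ eⱼ`.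
  have e : ((T n m : 𝒯) : H →L[ℂ] H) = star (star shift ^ n) * star shift ^ m := by
    rw [star_pow, star_star]; rfl
  rw [matrixCoeff_apply, e, mul_apply_eq_comp, ContinuousLinearMap.star_eq_adjoint (star shift ^ n),
    ContinuousLinearMap.adjoint_inner_right, star_shift_pow_basisVec, star_shift_pow_basisVec]
  by_cases h1 : n ≤ i <;> by_cases h2 : m ≤ j <;> simp [h1, h2, inner_basisVec]

/-- The functionals dual to the operators `T_{n,m}`. -/
def dualT : ℕ → ℕ → Dual𝒯
  | i + 1, j + 1 => matrixCoeff (i + 1) (j + 1) - matrixCoeff i j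
  | i, j => matrixCoeff i j

/-- The coefficient at `(i, j)` is one exactly on the `T (i - k) (j - k)` with `k ≤ min i j`.
Subtracting the preceding coefficient on the same diagonal leaves only `k = 0`. -/
theorem dualT_T (i j n m : ℕ) : dualT i j (T n m) = if i = n ∧ j = m then 1 else 0 := by
  rcases i with _ | i <;> rcases j with _ | j
  · simp only [dualT, matrixCoeff_T]
    congr 1; apply propext; omega
  · simp only [dualT, matrixCoeff_T]
    congr 1; apply propext; omega
  · simp only [dualT, matrixCoeff_T]
    congr 1; apply propext; omega
  · simp only [dualT, matrixCoeff_T, _root_.sub_apply]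
    split_ifs <;> first | omega | simp

/-- Functionals supported on an `n × n` block of generators form a finite-dimensional space, so
convergence of their values on that block gives norm convergence. -/
theorem eq_sum_dualT {g : Dual𝒯} {n : ℕ}
    (hg : ∀ a b, n ≤ a ∨ n ≤ b → g (T a b) = 0) :
    g = ∑ i ∈ Finset.range n, ∑ j ∈ Finset.range n, g (T i j) • dualT i j := by
  refine ext_T fun a b => ?_
  simp only [_root_.sum_apply, _root_.smul_apply, dualT_T, smul_eq_mul,
    mul_ite, mul_one, mul_zero, ite_and, Finset.sum_ite_irrel, Finset.sum_const_zero,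
    Finset.sum_ite_eq', Finset.mem_range]
  split_ifs with h1 h2
  · rfl
  · exact hg a b (by omega)
  · exact hg a b (by omega)

/-! ### The Haar functional -/

/-- The Haar functional, the vector state of `e₀`. -/
def haar : Dual𝒯 := matrixCoeff 0 0

theorem haar_T (n m : ℕ) : haar (T n m) = if (n, m) = (0, 0) then 1 else 0 := by
  rw [haar, matrixCoeff_T]
  congr 1
  simp

theorem isState_haar : IsState haar := by
  refine ⟨fun a => ?_, ?_⟩
  · rw [haar, matrixCoeff_apply]
    change 0 ≤ ⟪basisVec 0, (star (a : H →L[ℂ] H) * a) (basisVec 0)⟫_ℂ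
    rw [mul_apply_eq_comp, ContinuousLinearMap.star_eq_adjoint,
      ContinuousLinearMap.adjoint_inner_right, inner_self_eq_norm_sq_to_K]
    simp
  · rw [← T_zero_zero, haar_T, if_pos rfl]

theorem isHaarFunctional_haar : IsHaarFunctional haar := by
  -- Only the entry at `T 0 0 = 1` survives multiplication by the array of `haar`, so the scalar is
  -- `ρ 1`.
  refine ⟨isState_haar, fun ρ => ⟨ρ 1, ext_T fun n m => ?_, ext_T fun n m => ?_⟩⟩ <;>
  · rw [conv_T, _root_.smul_apply, haar_T, smul_eq_mul]
    split_ifs with h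
    · obtain ⟨rfl, rfl⟩ := Prod.ext_iff.1 h
      simp [T_zero_zero]
    · simp

/-- The product `conv h h'` is a multiple of both `h` and `h'`; evaluation at the unit shows that
both scalars are one. -/
theorem IsHaarFunctional.eq {h h' : Dual𝒯} (H1 : IsHaarFunctional h) (H2 : IsHaarFunctional h') :
    h = h' := by
  obtain ⟨c, hc, -⟩ := H1.2 h'
  obtain ⟨c', -, hc'⟩ := H2.2 h
  have e : conv h h' 1 = 1 := by
    rw [← T_zero_zero, conv_T, T_zero_zero, H1.1.2, H2.1.2, one_mul]
  have e1 : c = 1 := by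
    rw [hc, _root_.smul_apply, H1.1.2, smul_eq_mul, mul_one] at e
    exact e
  have e2 : c' = 1 := by
    rw [hc', _root_.smul_apply, H2.1.2, smul_eq_mul, mul_one] at e
    exact e
  rw [e1, one_smul] at hc
  rw [e2, one_smul] at hc'
  rw [← hc, hc']

/-! ### Estimates for states -/

theorem isStarProjection_T_self (n : ℕ) : IsStarProjection (T n n) :=
  ⟨T_self_mul_T_self n, star_T n n⟩

theorem isStarProjection_T_sub_T {n m : ℕ} (h : n ≤ m) : IsStarProjection (T n n - T m m) := by
  have h1 : T n n * T m m = T m m := T_self_mul_T m h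
  have h2 : T m m * T n n = T m m := by
    rw [← star_T m m, ← star_T n n, ← star_mul, star_T, h1, star_T]
  refine ⟨?_, by rw [IsSelfAdjoint, star_sub, star_T, star_T]⟩
  rw [IsIdempotentElem, mul_sub, sub_mul, sub_mul, T_self_mul_T_self, T_self_mul_T_self, h1, h2,
    sub_self, sub_zero]

theorem isStarProjection_one_sub_T (n : ℕ) : IsStarProjection (1 - T n n) := by
  rw [← T_zero_zero]
  exact isStarProjection_T_sub_T n.zero_le

theorem one_sub_T_mul_T {a n : ℕ} (b : ℕ) (h : n ≤ a) : (1 - T n n) * T a b = 0 := by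
  rw [sub_mul, one_mul, T_self_mul_T b h, sub_self]

theorem T_mul_one_sub_T {b n : ℕ} (a : ℕ) (h : n ≤ b) : T a b * (1 - T n n) = 0 := by
  rw [← star_star (T a b * (1 - T n n)), star_mul, (isStarProjection_one_sub_T n).2.star_eq,
    star_T, one_sub_T_mul_T a h, star_zero]

/-- A finite combination of the `T i j` lowers indices by a bounded amount, so it maps `e_l` with
`l` large into the span of the `e_i` with `i ≥ n`. -/
theorem one_sub_T_mul_mul_T {a : 𝒯} (ha : a ∈ spanT) (n : ℕ) :
    ∃ k, ∀ m, k ≤ m → (1 - T n n) * a * T m m = 0 := by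
  induction ha using Submodule.span_induction with
  | mem a ha =>
    obtain ⟨i, j, rfl⟩ := ha
    refine ⟨n + j, fun m hm => ?_⟩
    rw [mul_assoc, T_mul_T_self i (by omega), one_sub_T_mul_T _ (by omega)]
  | zero => exact ⟨0, fun m _ => by simp⟩
  | add a b _ _ h1 h2 =>
    obtain ⟨k, hk⟩ := h1
    obtain ⟨l, hl⟩ := h2
    refine ⟨max k l, fun m hm => ?_⟩
    rw [mul_add, add_mul, hk m (le_of_max_le_left hm), hl m (le_of_max_le_right hm), add_zero]
  | smul c a _ h =>
    obtain ⟨k, hk⟩ := h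
    refine ⟨k, fun m hm => ?_⟩
    rw [mul_smul_comm, smul_mul_assoc, hk m hm, smul_zero]

section State

variable {ρ : Dual𝒯} (hρ : IsState ρ)

include hρ

theorem IsState.nonneg_of_isStarProjection {p : 𝒯} (hp : IsStarProjection p) : 0 ≤ ρ p := by
  have h := hρ.1 p
  rwa [hp.2.star_eq, hp.1.eq] at h

theorem IsState.norm_apply_le_of_isStarProjection {p r : 𝒯} (hp : IsStarProjection p)
    (hr : IsStarProjection r) (a : 𝒯) :
    ‖ρ (p * a * r)‖ ≤ ‖a‖ * (√(ρ p).re * √(ρ r).re) := by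
  have h := norm_state_le hρ p a r
  rwa [hp.2.star_eq, hp.1.eq, hr.2.star_eq, hr.1.eq] at h

theorem IsState.antitone_T_self : Antitone fun n => (ρ (T n n)).re := by
  intro n m h
  have h1 := (Complex.nonneg_iff.1 (hρ.nonneg_of_isStarProjection (isStarProjection_T_sub_T h))).1
  rw [map_sub, Complex.sub_re] at h1
  exact sub_nonneg.1 h1

theorem IsState.T_self_nonneg (n : ℕ) : 0 ≤ (ρ (T n n)).re :=
  (Complex.nonneg_iff.1 (hρ.nonneg_of_isStarProjection (isStarProjection_T_self n))).1

theorem IsState.re_T_zero : (ρ (T 0 0)).re = 1 := by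
  rw [T_zero_zero, hρ.2, Complex.one_re]

theorem IsState.T_self_le_one (n : ℕ) : (ρ (T n n)).re ≤ 1 :=
  (hρ.antitone_T_self n.zero_le).trans_eq hρ.re_T_zero

theorem IsState.map_star (a : 𝒯) : ρ (star a) = conj (ρ a) := by
  -- Polarization: the values `z = 1` and `z = I` give the two real equations relating `ρ a` and `ρ
  -- (star a)`.
  have key : ∀ z : ℂ, (ρ ((star (z • (1 : 𝒯) + a)) * (z • (1 : 𝒯) + a))).im = 0 := fun z =>
    (Complex.nonneg_iff.1 (hρ.1 _)).2.symm
  have e : ∀ z : ℂ, ρ ((star (z • (1 : 𝒯) + a)) * (z • (1 : 𝒯) + a)) =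
      conj z * z + conj z * ρ a + z * ρ (star a) + ρ (star a * a) := by
    intro z
    have : (star (z • (1 : 𝒯) + a)) * (z • (1 : 𝒯) + a) =
        (conj z * z) • (1 : 𝒯) + conj z • a + z • star a + star a * a := by
      simp [add_mul, mul_add, smul_smul, mul_comm, add_assoc]
      abel
    rw [this]
    simp [hρ.2]
  have h0 := (Complex.nonneg_iff.1 (hρ.1 a)).2
  have h1 := key 1
  have h2 := key Complex.I
  rw [e] at h1 h2
  simp at h1 h2
  apply Complex.ext <;> simp <;> linarith

/-- For large `m` the right factor `T n n` may be replaced by the projection `T n n - T m m`, on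
which `ρ` is at most `ρ(T n n) - c`; Cauchy–Schwarz then gives the small factor. -/
theorem IsState.norm_corner_le {n : ℕ} {c : ℝ} (hc : ∀ m, c ≤ (ρ (T m m)).re) {a : 𝒯}
    (ha : a ∈ spanT) :
    ‖ρ ((1 - T n n) * a * T n n)‖ ≤ ‖a‖ * √((ρ (T n n)).re - c) := by
  obtain ⟨k, hk⟩ := one_sub_T_mul_mul_T ha n
  have hm := hk (max k n) (le_max_left _ _)
  set m := max k n
  have e : (1 - T n n) * a * T n n = (1 - T n n) * a * (T n n - T m m) := by
    rw [mul_sub, hm, sub_zero]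
  rw [e]
  refine (hρ.norm_apply_le_of_isStarProjection (isStarProjection_one_sub_T n)
    (isStarProjection_T_sub_T (le_max_right k n)) a).trans ?_
  refine mul_le_mul_of_nonneg_left ?_ (norm_nonneg a)
  have h1 : √(ρ (1 - T n n)).re ≤ 1 := by
    rw [map_sub, hρ.2, Complex.sub_re, Complex.one_re]
    exact Real.sqrt_le_one.2 (by linarith [hρ.T_self_nonneg n])
  have h2 : √(ρ (T n n - T m m)).re ≤ √((ρ (T n n)).re - c) := by
    rw [map_sub, Complex.sub_re]
    exact Real.sqrt_le_sqrt (by linarith [hc m])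
  exact (mul_le_mul h1 h2 (Real.sqrt_nonneg _) zero_le_one).trans_eq (one_mul _)

end State

/-! ### Compression to a finite corner -/

/-- The compression `A ↦ PAP` by the projection `P = 1 - T_{n,n}` onto the span of
`e₀, …, eₙ₋₁`. -/
def compression (n : ℕ) : 𝒯 →L[ℂ] 𝒯 :=
  ContinuousLinearMap.mulLeftRight ℂ 𝒯 (1 - T n n) (1 - T n n)

theorem compression_apply (n : ℕ) (a : 𝒯) :
    compression n a = (1 - T n n) * a * (1 - T n n) := rfl

theorem compression_T {n a b : ℕ} (h : n ≤ a ∨ n ≤ b) : compression n (T a b) = 0 := by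
  rw [compression_apply]
  rcases h with h | h
  · rw [one_sub_T_mul_T b h, zero_mul]
  · rw [mul_assoc, T_mul_one_sub_T a h, mul_zero]

theorem IsState.norm_sub_compression_le {ρ : Dual𝒯} (hρ : IsState ρ) (n : ℕ) {c : ℝ}
    (hc : ∀ m, c ≤ (ρ (T m m)).re) :
    ‖ρ - ρ ∘L compression n‖ ≤ (ρ (T n n)).re + 2 * √((ρ (T n n)).re - c) := by
  have hn := hρ.T_self_nonneg n
  refine ContinuousLinearMap.opNorm_le_bound _ (by positivity) fun a => ?_
  refine closure_minimal (s := (spanT : Set 𝒯)) (t := {a | ‖(ρ - ρ ∘L compression n) a‖ ≤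
    ((ρ (T n n)).re + 2 * √((ρ (T n n)).re - c)) * ‖a‖}) ?_
    (isClosed_le (ρ - ρ ∘L compression n).continuous.norm (continuous_norm.const_mul _)) (mem_closure_spanT a)
  intro b hb
  have h1 := hρ.norm_apply_le_of_isStarProjection (isStarProjection_T_self n)
    (isStarProjection_T_self n) b
  rw [Real.mul_self_sqrt hn] at h1
  have h2 := hρ.norm_corner_le (n := n) hc hb
  -- The corner `QbP` is the adjoint of `P b* Q`, so the same estimate applied to `star b` controls
  -- it.
  have h3 := hρ.norm_corner_le (n := n) hc (star_mem_spanT hb)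
  have hs : ‖star b‖ = ‖b‖ := norm_star (b : H →L[ℂ] H)
  rw [hs, ← RCLike.norm_conj, ← hρ.map_star, star_mul, star_mul, star_star, star_T,
    (isStarProjection_one_sub_T n).2.star_eq, ← mul_assoc] at h3
  have e : (ρ - ρ ∘L compression n) b = ρ (T n n * b * T n n) + ρ ((1 - T n n) * b * T n n)
      + ρ (T n n * b * (1 - T n n)) := by
    change ρ b - ρ ((1 - T n n) * b * (1 - T n n)) = _
    rw [← map_sub, ← map_add, ← map_add]
    congr 1
    noncomm_ring
  change ‖(ρ - ρ ∘L compression n) b‖ ≤ _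
  rw [e]
  refine norm_add₃_le.trans ?_
  linarith

/-! ### Convolution powers of a faithful state -/

section Faithful

variable {ρ : Dual𝒯} (hρ : IsState ρ) (hf : IsFaithful ρ)

include hρ hf

/-- Equality would make `ρ` vanish on the projection `1 - T n n`, which is nonzero because `haar`
takes the value one on it. -/
theorem IsFaithful.T_self_lt_one {n : ℕ} (hn : n ≠ 0) : (ρ (T n n)).re < 1 := by
  refine (hρ.T_self_le_one n).lt_of_ne fun h => ?_
  have hP := isStarProjection_one_sub_T n
  have h0 : 1 - T n n = 0 := by
    refine hf _ ?_
    have h1 := Complex.nonneg_iff.1 (hρ.nonneg_of_isStarProjection hP)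
    rw [hP.2.star_eq, hP.1.eq]
    apply Complex.ext
    · rw [map_sub, hρ.2, Complex.sub_re, h, Complex.one_re, sub_self, Complex.zero_re]
    · exact h1.2.symm
  have h2 := congrArg haar h0
  rw [map_sub, isState_haar.2, haar_T, if_neg (by simp [hn]), map_zero, sub_zero] at h2
  exact one_ne_zero h2

theorem IsFaithful.norm_T_lt_one {n m : ℕ} (h : (n, m) ≠ (0, 0)) : ‖ρ (T n m)‖ < 1 := by
  -- Cauchy–Schwarz for `T*ⁿ` and `T*ᵐ`: the bound is `√ρ(T n n) * √ρ(T m m)`, and one of the two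
  -- factors is below one.
  have h1 := norm_state_le hρ (star genT ^ n) 1 (star genT ^ m)
  have e : ∀ k l, star (star genT ^ k) * star genT ^ l = T k l := fun k l => by
    rw [star_pow, star_star, T]
  rw [mul_one, e, e, e] at h1
  have hone : ‖(1 : 𝒯)‖ ≤ 1 := by
    change ‖(1 : H →L[ℂ] H)‖ ≤ 1
    exact ContinuousLinearMap.norm_id_le
  refine h1.trans_lt ((mul_le_of_le_one_left (by positivity) hone).trans_lt ?_)
  have hs : ∀ k, √(ρ (T k k)).re ≤ 1 := fun k => Real.sqrt_le_one.2 (hρ.T_self_le_one k)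
  have hs' : ∀ k, k ≠ 0 → √(ρ (T k k)).re < 1 := fun k hk =>
    (Real.sqrt_lt' one_pos).2 (by rw [one_pow]; exact hf.T_self_lt_one hρ hk)
  by_cases hn : n = 0
  · have hm : m ≠ 0 := by rintro rfl; exact h (by rw [hn])
    exact mul_lt_one_of_nonneg_of_lt_one_right (hs n) (Real.sqrt_nonneg _) (hs' m hm)
  · exact mul_lt_one_of_nonneg_of_lt_one_left (Real.sqrt_nonneg _) (hs' n hn) (hs m)

/-- A faithful state is a strict contraction up to its restriction to a corner. -/
theorem IsFaithful.exists_norm_sub_compression_lt_one :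
    ∃ n, n ≠ 0 ∧ ‖ρ - ρ ∘L compression n‖ < 1 := by
  have hb : BddBelow (Set.range fun n => (ρ (T n n)).re) :=
    ⟨0, by rintro _ ⟨n, rfl⟩; exact hρ.T_self_nonneg n⟩
  set c := ⨅ n, (ρ (T n n)).re
  have hc : ∀ m, c ≤ (ρ (T m m)).re := fun m => ciInf_le hb m
  have hc1 : c < 1 := (hc 1).trans_lt (hf.T_self_lt_one hρ one_ne_zero)
  have ht : Tendsto (fun n => (ρ (T n n)).re) atTop (𝓝 c) :=
    tendsto_atTop_ciInf hρ.antitone_T_self hb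
  have ht2 : Tendsto (fun n => (ρ (T n n)).re + 2 * √((ρ (T n n)).re - c)) atTop (𝓝 c) := by
    have := ht.add ((ht.sub_const c).sqrt.const_mul 2)
    simpa using this
  obtain ⟨n, hn, hn0⟩ := ((ht2.eventually_lt_const hc1).and (eventually_ne_atTop 0)).exists
  exact ⟨n, hn0, (hρ.norm_sub_compression_le n hc).trans_lt hn⟩

theorem IsFaithful.tendsto_convPowSucc : Tendsto (convPowSucc ρ) atTop (𝓝 haar) := by
  obtain ⟨n, hn0, hn⟩ := hf.exists_norm_sub_compression_lt_one hρ
  set τ := ρ - ρ ∘L compression n with hτ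
  have hpow : ∀ z : ℂ, ‖z‖ < 1 → Tendsto (fun k => z ^ (k + 1)) atTop (𝓝 0) := fun z hz =>
    (tendsto_add_atTop_iff_nat 1).2 (tendsto_pow_atTop_nhds_zero_of_norm_lt_one hz)
  -- The index `k` stands for the power `k + 1`, hence the shift by one in the geometric sequence.
  have h1 : Tendsto (convPowSucc τ) atTop (𝓝 0) :=
    squeeze_zero_norm (E := Dual𝒯) (norm_convPowSucc_le τ) ((tendsto_add_atTop_iff_nat 1).2
      (tendsto_pow_atTop_nhds_zero_of_lt_one (norm_nonneg τ) hn))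
  have hT : ∀ a b, Tendsto (fun k => (convPowSucc ρ k - convPowSucc τ k) (T a b)) atTop
      (𝓝 (haar (T a b))) := by
    intro a b
    have h2 : Tendsto (fun k => convPowSucc τ k (T a b)) atTop (𝓝 0) := by
      have := ((ContinuousLinearMap.apply ℂ ℂ (T a b)).continuous.tendsto _).comp h1
      rwa [map_zero] at this
    have h3 : Tendsto (fun k => convPowSucc ρ k (T a b)) atTop (𝓝 (haar (T a b))) := by
      simp only [convPowSucc_T]
      rw [haar_T]
      split_ifs with h
      · obtain ⟨rfl, rfl⟩ := Prod.ext_iff.1 h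
        simp [T_zero_zero, hρ.2]
      · exact hpow _ (hf.norm_T_lt_one hρ h)
    simpa using h3.sub h2
  -- Outside the `n × n` block `τ` and `ρ` have the same entries, hence so do all their powers.
  have hz : ∀ k a b, n ≤ a ∨ n ≤ b → (convPowSucc ρ k - convPowSucc τ k) (T a b) = 0 := by
    intro k a b hab
    have : τ (T a b) = ρ (T a b) := by
      rw [hτ, _root_.sub_apply, ContinuousLinearMap.comp_apply, compression_T hab, map_zero,
        sub_zero]
    rw [_root_.sub_apply, convPowSucc_T, convPowSucc_T, this, sub_self]
  have h4 : Tendsto (fun k => convPowSucc ρ k - convPowSucc τ k) atTop (𝓝 haar) := by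
    -- Here `n ≠ 0` matters: the only nonzero entry of `haar`, at `(0, 0)`, must lie in the block.
    rw [eq_sum_dualT (g := haar) (n := n) fun a b hab => by
      rw [haar_T, if_neg]
      rintro h
      obtain ⟨rfl, rfl⟩ := Prod.ext_iff.1 h
      omega]
    refine Tendsto.congr (fun k => (eq_sum_dualT (hz k)).symm) ?_
    exact tendsto_finsetSum _ fun i _ => tendsto_finsetSum _ fun j _ =>
      (hT i j).smul_const (dualT i j)
  simpa using h4.add h1

theorem IsFaithful.tendsto_cesaro : Tendsto (cesaro ρ) atTop (𝓝 haar) := by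
  refine (Filter.Tendsto.cesaro_smul (E := Dual𝒯) (hf.tendsto_convPowSucc hρ)).congr fun N => ?_
  -- The general Cesàro theorem scales by a real `N⁻¹`, while `cesaro` scales by a complex one.
  rw [cesaro, ← Complex.coe_smul, Complex.ofReal_inv, Complex.ofReal_natCast]

end Faithful

end Toeplitz

end

open Toeplitz in
/-- There is exactly one Haar functional `h` in `𝒯*`; and if `ρ` is a faithful state on `𝒯`, then
`|ρ(T_{n,m})| < 1` for `(n,m) ≠ (0,0)`, and the Cesàro means `ρ_N = (1/N) ∑_{k=1}^N ρ^{∗k}`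
converge to `h`: on each generator `T_{n,m}`, with the limit `h(T_{n,m})` equal to `1` if
`(n,m) = (0,0)` and to `0` otherwise; at each `A ∈ 𝒯`; and in the norm of `𝒯*`. -/
theorem mainTheorem7 :
    (∃! h : Dual𝒯, IsHaarFunctional h) ∧
    ∀ h : Dual𝒯, IsHaarFunctional h → ∀ ρ : Dual𝒯, IsState ρ → IsFaithful ρ →
      (∀ n m : ℕ, (n, m) ≠ (0, 0) → ‖ρ (T n m)‖ < 1) ∧
      (∀ n m : ℕ, h (T n m) = if (n, m) = (0, 0) then 1 else 0) ∧
      (∀ n m : ℕ, Tendsto (fun N => cesaro ρ N (T n m)) atTop (𝓝 (h (T n m)))) ∧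
      (∀ A : 𝒯, Tendsto (fun N => cesaro ρ N A) atTop (𝓝 (h A))) ∧
      Tendsto (fun N => cesaro ρ N) atTop (𝓝 h) := by
  refine ⟨⟨haar, isHaarFunctional_haar, fun h hh => hh.eq isHaarFunctional_haar⟩, ?_⟩
  intro h hh ρ hρ hf
  obtain rfl : h = haar := hh.eq isHaarFunctional_haar
  have hN : Tendsto (fun N => cesaro ρ N) atTop (𝓝 haar) := hf.tendsto_cesaro hρ
  have hA : ∀ A : 𝒯, Tendsto (fun N => cesaro ρ N A) atTop (𝓝 (haar A)) := fun A =>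
    ((ContinuousLinearMap.apply ℂ ℂ A).continuous.tendsto haar).comp hN
  exact ⟨fun n m hnm => hf.norm_T_lt_one hρ hnm, haar_T, fun n m => hA _, hA, hN⟩
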